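/- Let $\mathrm{ReLU}(u)=\max\{0,u\}$. ReLU regression on $\mathbb{R}^d$ under Gaussian marginals with excess error $\epsilon$ is the following task: for an unknown distribution $\mathcal D$ of labelled examples $(\mathbf{x},y)\in\mathbb{R}^d\times[-1,1]$ whose marginal on $\mathbb{R}^d$ is the standard Gaussian $\mathcal N(0,I)$ (with no further assumption on the labels $y$), output a hypothesis $h:\mathbb{R}^d\to\mathbb{R}$ such that, with probability at least $2/3$, $$\mathbf{E}_{(\mathbf{x},y)\sim\mathcal D}[(h(\mathbf{x})-y)^2]\le \mathrm{OPT}+\epsilon,\qquad \mathrm{OPT}=\inf_{\mathbf{w}\in\mathbb{R}^d,\ \theta\in\mathbb{R}}\mathbf{E}_{(\mathbf{x},y)\sim\mathcal D}\big[(\mathrm{ReLU}(\langle \mathbf{w},\mathbf{x}\rangle+\theta)-y)^2\big].$$ A (possibly randomized and adaptive) statistical query (SQ) algorithm has access to $\mathcal D$ only through an oracle $\mathrm{STAT}(\tau)$, which answers a query $q:\mathbb{R}^d\times[-1,1]\to[-1,1]$ with some value $v$ such that $|v-\mathbf{E}_{(\mathbf{x},y)\sim\mathcal D}[q(\mathbf{x},y)]|\le\tau$;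 the algorithm has to succeed for every such oracle. Theorem. There exist constants $c,c',\epsilon_0>0$ such that the following holds. For every $d\ge 1$ and every $\epsilon$ with $d^{-c}\le\epsilon\le\epsilon_0$, any SQ algorithm with excess error $\epsilon$ for ReLU regression on $\mathbb{R}^d$ under Gaussian marginals requires at least $d^{c/\epsilon^{c'}}$ statistical queries to $\mathrm{STAT}(d^{-c/\epsilon^{c'}})$. -/

import Mathlib

open MeasureTheory
open scoped ENNReal

namespace ReLURegression

/-- The domain `ℝᵈ`, with the Euclidean inner product. -/
abbrev Point (d : ℕ) : Type := EuclideanSpace ℝ (Fin d)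

/-- The function `ReLU(u) = max {0, u}`. -/
noncomputable def relu (u : ℝ) : ℝ := max 0 u

/-- The function `x ↦ ReLU(⟨w, x⟩ + θ)` with weight vector `w` and threshold `θ`. -/
noncomputable def reluUnit {d : ℕ} (w : Point d) (θ : ℝ) (x : Point d) : ℝ :=
  relu (inner ℝ w x + θ)

/-- The square loss `E_{(x,y) ∼ D} [(h(x) - y)²]`, as an element of `[0, ∞]`. -/
noncomputable def sqLoss {d : ℕ} (D : Measure (Point d × ℝ)) (h : Point d → ℝ) : ℝ≥0∞ :=
  ∫⁻ p, ENNReal.ofReal ((h p.1 - p.2) ^ 2) ∂D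

/-- `OPT`: the infimum of the square loss over all ReLUs. -/
noncomputable def opt {d : ℕ} (D : Measure (Point d × ℝ)) : ℝ≥0∞ :=
  ⨅ (w : Point d) (θ : ℝ), sqLoss D (reluUnit w θ)

/-- The distributions of labelled examples `(x, y)`: the `x`-marginal is the standard Gaussian on
`ℝᵈ`, the labels lie in `[-1, 1]`, and the label may depend on `x` in any (randomized) way. -/
structure IsInstance {d : ℕ} (D : Measure (Point d × ℝ)) : Prop where
  isProbabilityMeasure : IsProbabilityMeasure D
  marginal : D.map Prod.fst = ProbabilityTheory.stdGaussian (Point d)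
  label_mem : ∀ᵐ p ∂D, p.2 ∈ Set.Icc (-1 : ℝ) 1

/-- A statistical query: a measurable function of the example with values in `[-1, 1]`. -/
structure Query (d : ℕ) where
  toFun : Point d × ℝ → ℝ
  measurable : Measurable toFun
  mem_Icc : ∀ p, toFun p ∈ Set.Icc (-1 : ℝ) 1

/-- `O` is a `STAT(τ)` oracle for `D`: it answers every query by its expectation under `D`, up to
an (arbitrary) error of absolute value at most `τ`. -/
def IsSTAT {d : ℕ} (τ : ℝ) (D : Measure (Point d × ℝ)) (O : Query d → ℝ) : Prop :=
  ∀ q : Query d, |O q - ∫ p, q.toFun p ∂D| ≤ τ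

/-- A deterministic adaptive SQ algorithm: it either stops and outputs a (measurable) hypothesis, or
asks a query and continues in a way that depends on the answer. There is no restriction on its
computational power. -/
inductive SQAlg (d : ℕ) : Type where
  | output (h : Point d → ℝ) (hh : Measurable h) : SQAlg d
  | query (q : Query d) (next : ℝ → SQAlg d) : SQAlg d

namespace SQAlg

/-- The hypothesis that the algorithm outputs when the oracle `O` answers its queries. -/
def run {d : ℕ} (O : Query d → ℝ) : SQAlg d → (Point d → ℝ)
  | output h _ => h
  | query q next => run O (next (O q))

/-- The number of queries that the algorithm asks when the oracle `O` answers them. -/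
def numQueries {d : ℕ} (O : Query d → ℝ) : SQAlg d → ℕ
  | output _ _ => 0
  | query q next => numQueries O (next (O q)) + 1

end SQAlg

/-- A randomized SQ algorithm: it draws a random seed from a probability space and runs the
deterministic algorithm that belongs to the seed. -/
structure RandSQAlg (d : ℕ) where
  Seed : Type
  measurableSpace : MeasurableSpace Seed
  law : @Measure Seed measurableSpace
  isProbabilityMeasure : IsProbabilityMeasure law
  alg : Seed → SQAlg d

/-- `A` makes at most `n` queries whenever it is run with a `STAT(τ)` oracle for an instance. -/
def RandSQAlg.QueriesAtMost {d : ℕ} (A : RandSQAlg d) (τ : ℝ) (n : ℕ) : Prop :=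
  ∀ D : Measure (Point d × ℝ), IsInstance D → ∀ O : Query d → ℝ, IsSTAT τ D O →
    ∀ ω : A.Seed, (A.alg ω).numQueries O ≤ n

/-- `A`, run with `STAT(τ)`, performs ReLU regression under Gaussian marginals with excess error
`ε`: for every instance and every `STAT(τ)` oracle for it, with probability at least `2/3` over the
seed, the square loss of the output is at most `OPT + ε`. (The event of success need not be
measurable; it has to contain a measurable event of probability at least `2/3`.) -/
def RandSQAlg.Learns {d : ℕ} (A : RandSQAlg d) (τ ε : ℝ) : Prop :=
  ∀ D : Measure (Point d × ℝ), IsInstance D → ∀ O : Query d → ℝ, IsSTAT τ D O →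
    ∃ S : Set A.Seed, MeasurableSet[A.measurableSpace] S ∧ 2 / 3 ≤ A.law S ∧
      ∀ ω ∈ S, sqLoss D ((A.alg ω).run O) ≤ opt D + ENNReal.ofReal ε

end ReLURegression

/-! The hard instances hide a direction `v`: the label is `±1` with conditional mean `gaussWave m
⟨v, x⟩`. Times the Gaussian density, this wave is a multiple of `sin ((2m+1) arccos t)` on `[-1,
1]`, which is Lebesgue-orthogonal to all polynomials of degree below `2m`. Two facts pull against
each other.

Waves in directions with inner product `ρ ∈ [0, 1/4]` have correlation at most `4(2ρ)^m`
(`abs_integral_gaussWave_le`), exponentially small in `m`. Graphs of polynomials over `ZMod p`, with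
`p ≈ √d`, supply `p^m` directions with pairwise `ρ ≤ m/p`.

The kink of ReLU, however, gives correlation of order `m⁻²` with the wave
(`integral_gaussWave_mul_relu`), so a ReLU beats the trivial loss `1` by order `m⁻⁴`
(`opt_labelled_gaussWave_le`). A learner with excess error well below `m⁻⁴` must therefore find
information about `v`.

For nearly uncorrelated functions, a query separates only few instances from the null distribution
(labels independent of `x`), and a single hypothesis is good for only few instances. Answering as
under the null whenever permitted then forces many queries (`RandSQAlg.card_le`). Taking `m ≈
ε^(-1/8)` gives the theorem. -/

namespace ReLURegression

open ProbabilityTheory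

/-! ### Random `±1` labels with a prescribed conditional mean. -/

section Labelled

variable {d : ℕ}

/-- The distribution of `(x, y)` with `x` standard Gaussian, `y = ±1` and `E[y | x] = f x`. -/
noncomputable def labelled (f : Point d → ℝ) : Measure (Point d × ℝ) :=
  ((stdGaussian (Point d)).withDensity fun x => ENNReal.ofReal ((1 + f x) / 2)).map
      (fun x => (x, (1 : ℝ))) +
    ((stdGaussian (Point d)).withDensity fun x => ENNReal.ofReal ((1 - f x) / 2)).map
      (fun x => (x, (-1 : ℝ)))

lemma lintegral_labelled {f : Point d → ℝ} (hf : Measurable f)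
    {g : Point d × ℝ → ℝ≥0∞} (hg : Measurable g) :
    ∫⁻ p, g p ∂labelled f = ∫⁻ x, (ENNReal.ofReal ((1 + f x) / 2) * g (x, 1) +
      ENNReal.ofReal ((1 - f x) / 2) * g (x, -1)) ∂stdGaussian (Point d) := by
  rw [labelled, lintegral_add_measure, lintegral_map hg (by fun_prop), lintegral_map hg (by fun_prop),
    lintegral_withDensity_eq_lintegral_mul _ (by fun_prop) (by fun_prop),
    lintegral_withDensity_eq_lintegral_mul _ (by fun_prop) (by fun_prop),
    ← lintegral_add_left (by fun_prop)]
  rfl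

lemma labelled_instance {f : Point d → ℝ} (hf : Measurable f) (hf1 : ∀ x, |f x| ≤ 1) :
    IsInstance (labelled f) := by
  have key : (labelled f).map Prod.fst = stdGaussian (Point d) := by
    ext s hs
    rw [Measure.map_apply measurable_fst hs, ← lintegral_indicator_one (measurable_fst hs),
      lintegral_labelled hf (measurable_one.indicator (measurable_fst hs)),
      ← lintegral_indicator_one hs]
    refine lintegral_congr fun x => ?_
    have h := abs_le.1 (hf1 x)
    by_cases hx : x ∈ s
    · have : ENNReal.ofReal ((1 + f x) / 2) + ENNReal.ofReal ((1 - f x) / 2) = 1 := by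
        rw [← ENNReal.ofReal_add (by linarith) (by linarith), ← ENNReal.ofReal_one]
        congr 1; ring
      simpa [Set.indicator, hx] using this
    · simp [Set.indicator, hx]
  refine ⟨⟨?_⟩, key, ?_⟩
  · rw [← Set.preimage_univ (f := (Prod.fst : Point d × ℝ → Point d)),
      ← Measure.map_apply measurable_fst .univ, key, measure_univ]
  · have hm : MeasurableSet {p : Point d × ℝ | ¬ p.2 ∈ Set.Icc (-1 : ℝ) 1} :=
      (measurable_snd measurableSet_Icc).compl
    rw [ae_iff, ← lintegral_indicator_one hm, lintegral_labelled hf (measurable_one.indicator hm)]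
    simp [Set.indicator, not_lt.2 (zero_le_one' ℝ)]

lemma integrable_of_abs_le {α : Type*} [MeasurableSpace α] {μ : Measure α} [IsFiniteMeasure μ]
    {f : α → ℝ} (hf : Measurable f) {C : ℝ} (h : ∀ x, |f x| ≤ C) : Integrable f μ :=
  Integrable.of_bound hf.aestronglyMeasurable C (.of_forall h)

lemma integral_labelled {f : Point d → ℝ} (hf : Measurable f) (hf1 : ∀ x, |f x| ≤ 1)
    (q : Query d) :
    ∫ p, q.toFun p ∂labelled f = ∫ x, ((1 + f x) / 2 * q.toFun (x, 1) +
      (1 - f x) / 2 * q.toFun (x, -1)) ∂stdGaussian (Point d) := by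
  have hq := q.measurable
  have := (labelled_instance hf hf1).isProbabilityMeasure
  have hb : ∀ p, |q.toFun p| ≤ 1 := fun p => abs_le.2 (q.mem_Icc p)
  have hi : Integrable q.toFun (labelled f) := integrable_of_abs_le hq hb
  have hp : ∀ x, 0 ≤ (1 + f x) / 2 := fun x => by linarith [(abs_le.1 (hf1 x)).1]
  have hn : ∀ x, 0 ≤ (1 - f x) / 2 := fun x => by linarith [(abs_le.1 (hf1 x)).2]
  have hm : ∀ (y s : ℝ), (s = 1 ∨ s = -1) → Integrable (fun x => (1 + s * f x) / 2 * q.toFun (x, y))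
      (stdGaussian (Point d)) := by
    intro y s hs
    refine integrable_of_abs_le (C := 1) (by fun_prop) fun x => ?_
    rw [abs_mul]
    have h1 : |(1 + s * f x) / 2| ≤ 1 := by
      have := abs_le.1 (hf1 x)
      rcases hs with rfl | rfl <;> rw [abs_le] <;> constructor <;> linarith
    exact mul_le_one₀ h1 (abs_nonneg _) (hb _)
  have hi' := hi
  rw [labelled] at hi' ⊢
  rw [integral_add_measure hi'.left_of_add_measure hi'.right_of_add_measure,
    integral_map (by fun_prop) (by fun_prop), integral_map (by fun_prop) (by fun_prop),
    integral_withDensity_eq_integral_toReal_smul (by fun_prop) (by simp),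
    integral_withDensity_eq_integral_toReal_smul (by fun_prop) (by simp), ← integral_add]
  · simp [ENNReal.toReal_ofReal, hp, hn]
  · simpa [ENNReal.toReal_ofReal, hp] using hm 1 1 (.inl rfl)
  · simpa [ENNReal.toReal_ofReal, hn, ← sub_eq_add_neg] using hm (-1) (-1) (.inr rfl)

/-- Only the part of a query that is odd in the label distinguishes the instance from the null, so
every query acts as a correlation of `f` with a function bounded by `1`. -/
lemma integral_labelled_sub {f : Point d → ℝ} (hf : Measurable f) (hf1 : ∀ x, |f x| ≤ 1)
    (q : Query d) :
    ∫ p, q.toFun p ∂labelled f - ∫ p, q.toFun p ∂labelled (fun _ : Point d => 0) =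
      ∫ x, f x * ((q.toFun (x, 1) - q.toFun (x, -1)) / 2) ∂stdGaussian (Point d) := by
  have hq := q.measurable
  have hb : ∀ p, |q.toFun p| ≤ 1 := fun p => abs_le.2 (q.mem_Icc p)
  rw [integral_labelled hf hf1, integral_labelled measurable_const (by simp), ← integral_sub]
  · exact integral_congr_ae (.of_forall fun x => by ring)
  · refine integrable_of_abs_le (C := 2) (by fun_prop) fun x => ?_
    have h1 := abs_le.1 (hf1 x)
    refine (abs_add_le _ _).trans ?_
    rw [abs_mul, abs_mul]
    have e1 : |(1 + f x) / 2| ≤ 1 := by rw [abs_le]; constructor <;> linarith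
    have e2 : |(1 - f x) / 2| ≤ 1 := by rw [abs_le]; constructor <;> linarith
    have := mul_le_one₀ e1 (abs_nonneg _) (hb (x, 1))
    have := mul_le_one₀ e2 (abs_nonneg _) (hb (x, -1))
    linarith
  · refine integrable_of_abs_le (C := 1) (by fun_prop) fun x => ?_
    have h1 := abs_le.1 (hb (x, 1))
    have h2 := abs_le.1 (hb (x, -1))
    rw [abs_le]; constructor <;> linarith

lemma sqLoss_labelled {f : Point d → ℝ} (hf : Measurable f) (hf1 : ∀ x, |f x| ≤ 1)
    {h : Point d → ℝ} (hh : Measurable h) :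
    sqLoss (labelled f) h =
      ∫⁻ x, ENNReal.ofReal (h x ^ 2 - 2 * h x * f x + 1) ∂stdGaussian (Point d) := by
  rw [sqLoss, lintegral_labelled hf (by fun_prop)]
  refine lintegral_congr fun x => ?_
  have h1 := abs_le.1 (hf1 x)
  rw [← ENNReal.ofReal_mul (by linarith), ← ENNReal.ofReal_mul (by linarith),
    ← ENNReal.ofReal_add (mul_nonneg (by linarith) (sq_nonneg _))
      (mul_nonneg (by linarith) (sq_nonneg _))]
  congr 1
  ring

/-! ### Nearly uncorrelated families. -/

section Family

variable {ι : Type*} {f : ι → Point d → ℝ} {η : ℝ}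

lemma integral_sq_sum_le (hf : ∀ i, Measurable (f i)) (hf1 : ∀ i x, |f i x| ≤ 1) (hη0 : 0 ≤ η)
    (hη : ∀ i j, i ≠ j → |∫ x, f i x * f j x ∂stdGaussian (Point d)| ≤ η)
    (S : Finset ι) {c : ι → ℝ} (hc : ∀ i, |c i| ≤ 1) :
    ∫ x, (∑ i ∈ S, c i * f i x) ^ 2 ∂stdGaussian (Point d) ≤ S.card + (S.card : ℝ) ^ 2 * η := by
  classical
  have hprod : ∀ i j x, |f i x * f j x| ≤ 1 := fun i j x => by
    rw [abs_mul]; exact mul_le_one₀ (hf1 i x) (abs_nonneg _) (hf1 j x)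
  have hint : ∀ i j, Integrable (fun x => f i x * f j x) (stdGaussian (Point d)) := fun i j =>
    integrable_of_abs_le ((hf i).mul (hf j)) (hprod i j)
  have e : ∀ x, (∑ i ∈ S, c i * f i x) ^ 2 =
      ∑ i ∈ S, ∑ j ∈ S, (c i * c j) * (f i x * f j x) := fun x => by
    rw [sq, Finset.sum_mul_sum]
    exact Finset.sum_congr rfl fun i _ => Finset.sum_congr rfl fun j _ => by ring
  simp_rw [e]
  rw [integral_finsetSum _ fun i _ => integrable_finsetSum _ fun j _ => (hint i j).const_mul _]
  have hle : ∀ i ∈ S, ∫ x, ∑ j ∈ S, (c i * c j) * (f i x * f j x) ∂stdGaussian (Point d) ≤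
      1 + S.card * η := by
    intro i hi
    rw [integral_finsetSum _ fun j _ => (hint i j).const_mul _]
    have : ∀ j ∈ S, ∫ x, (c i * c j) * (f i x * f j x) ∂stdGaussian (Point d) ≤
        (if i = j then 1 else 0) + η := by
      intro j _
      rw [integral_const_mul]
      refine (le_abs_self _).trans ?_
      rw [abs_mul]
      have hcc : |c i * c j| ≤ 1 := by
        rw [abs_mul]; exact mul_le_one₀ (hc i) (abs_nonneg _) (hc j)
      refine (mul_le_of_le_one_left (abs_nonneg _) hcc).trans ?_
      split_ifs with h
      · have := norm_integral_le_of_norm_le_const (μ := stdGaussian (Point d))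
          (f := fun x => f i x * f j x) (C := 1) (.of_forall fun x => hprod i j x)
        simp only [Real.norm_eq_abs, probReal_univ, mul_one] at this
        linarith
      · simpa using hη i j h
    refine (Finset.sum_le_sum this).trans ?_
    rw [Finset.sum_add_distrib, Finset.sum_ite_eq, if_pos hi]
    simp
  refine (Finset.sum_le_sum hle).trans ?_
  simp only [Finset.sum_const, nsmul_eq_mul]
  exact le_of_eq (by ring)

/-- A Bessel-type bound. With signs `c i` aligning the correlations and `T = ∑ c i f i`,
Cauchy–Schwarz (used pointwise as AM-GM) gives `(Nτ)² ≤ E[T²] ≤ N + N²η`; then `2η ≤ τ²` absorbs the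
last term. -/
lemma card_mul_sq_le_of_correlated (hf : ∀ i, Measurable (f i)) (hf1 : ∀ i x, |f i x| ≤ 1)
    (hη0 : 0 ≤ η) (hη : ∀ i j, i ≠ j → |∫ x, f i x * f j x ∂stdGaussian (Point d)| ≤ η)
    (S : Finset ι) {g : Point d → ℝ} (hg : Measurable g) (hg1 : ∀ x, |g x| ≤ 1) {τ : ℝ}
    (hτ : 0 < τ) (hητ : 2 * η ≤ τ ^ 2)
    (hS : ∀ i ∈ S, τ < |∫ x, f i x * g x ∂stdGaussian (Point d)|) :
    S.card * τ ^ 2 ≤ 2 := by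
  rcases S.eq_empty_or_nonempty with rfl | hne
  · simp
  have hN : (0 : ℝ) < S.card := by exact_mod_cast hne.card_pos
  set N : ℝ := (S.card : ℝ)
  let c : ι → ℝ := fun i => SignType.sign (∫ x, f i x * g x ∂stdGaussian (Point d))
  have hc : ∀ i, |c i| ≤ 1 := fun i => by
    simp only [c]
    rcases SignType.sign (∫ x, f i x * g x ∂stdGaussian (Point d)) <;> simp
  have hint : ∀ i, Integrable (fun x => f i x * g x) (stdGaussian (Point d)) := fun i =>
    integrable_of_abs_le (C := 1) ((hf i).mul hg) fun x => by
      rw [abs_mul]; exact mul_le_one₀ (hf1 i x) (abs_nonneg _) (hg1 x)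
  have hT : Measurable fun x => ∑ i ∈ S, c i * f i x := by fun_prop
  have hTb : ∀ x, |∑ i ∈ S, c i * f i x| ≤ N := fun x => by
    refine (Finset.abs_sum_le_sum_abs _ _).trans ?_
    refine (Finset.sum_le_card_nsmul _ _ 1 fun i _ => ?_).trans (by simp [N])
    rw [abs_mul]; exact mul_le_one₀ (hc i) (abs_nonneg _) (hf1 i x)
  have hTi : Integrable (fun x => (∑ i ∈ S, c i * f i x) ^ 2) (stdGaussian (Point d)) :=
    integrable_of_abs_le (C := N ^ 2) (by fun_prop) fun x => by
      rw [abs_pow]; exact pow_le_pow_left₀ (abs_nonneg _) (hTb x) 2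
  have h1 : N * τ ≤ ∫ x, (∑ i ∈ S, c i * f i x) * g x ∂stdGaussian (Point d) := by
    have e : ∀ x, (∑ i ∈ S, c i * f i x) * g x = ∑ i ∈ S, c i * (f i x * g x) := fun x => by
      rw [Finset.sum_mul]; exact Finset.sum_congr rfl fun i _ => by ring
    simp_rw [e]
    rw [integral_finsetSum _ fun i _ => (hint i).const_mul _, ← nsmul_eq_mul]
    refine Finset.card_nsmul_le_sum _ _ _ fun i hi => ?_
    rw [integral_const_mul, sign_mul_self]
    exact (hS i hi).le
  have h2 : ∫ x, (∑ i ∈ S, c i * f i x) * g x ∂stdGaussian (Point d) ≤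
      ∫ x, (N * τ / 2 + (∑ i ∈ S, c i * f i x) ^ 2 * (2 * (N * τ))⁻¹) ∂stdGaussian (Point d) := by
    refine integral_mono (integrable_of_abs_le (C := N) (hT.mul hg) fun x => ?_)
      ((integrable_const _).add (hTi.mul_const _)) fun x => ?_
    · rw [abs_mul]
      exact (mul_le_of_le_one_right (abs_nonneg _) (hg1 x)).trans (hTb x)
    · have hpos : 0 < N * τ := by positivity
      set T := ∑ i ∈ S, c i * f i x
      have hg2 : g x ^ 2 ≤ 1 := by
        rw [← sq_abs]; exact pow_le_one₀ (abs_nonneg _) (hg1 x)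
      have : N * τ / 2 + T ^ 2 * (2 * (N * τ))⁻¹ - T * g x =
          ((T - N * τ * g x) ^ 2 + (N * τ) ^ 2 * (1 - g x ^ 2)) * (2 * (N * τ))⁻¹ := by
        field_simp; ring
      have h0 : 0 ≤ ((T - N * τ * g x) ^ 2 + (N * τ) ^ 2 * (1 - g x ^ 2)) * (2 * (N * τ))⁻¹ := by
        have : 0 ≤ 1 - g x ^ 2 := by linarith
        positivity
      change T * g x ≤ _
      linarith
  rw [integral_add (integrable_const _) (hTi.mul_const _), integral_mul_const] at h2
  have h3 := integral_sq_sum_le hf hf1 hη0 hη S hc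
  have h4 := h1.trans (h2.trans (add_le_add_right (mul_le_mul_of_nonneg_right h3
    (by positivity : 0 ≤ (2 * (N * τ))⁻¹)) _))
  simp only [integral_const, probReal_univ, smul_eq_mul, one_mul] at h4
  change N * τ ≤ N * τ / 2 + (N + N ^ 2 * η) * (2 * (N * τ))⁻¹ at h4
  have h5 : (N + N ^ 2 * η) * (2 * (N * τ))⁻¹ = (1 + N * η) / (2 * τ) := by
    field_simp
  rw [h5] at h4
  have h6 : N * τ / 2 ≤ (1 + N * η) / (2 * τ) := by linarith
  rw [le_div_iff₀ (by positivity)] at h6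
  nlinarith

/-- Pointwise, the sum of the `N` losses is smallest at the average `h = T/N`, where `T = ∑ f i`,
with value `N - T²/N`. Near-orthogonality makes `E[T²]/N` at most `1 + Nη`, so the average loss
cannot be far below `1` for large `N`. Integrals stay in `[0, ∞]` since `h` need not be square
integrable. -/
lemma card_mul_le_of_sqLoss_le (hf : ∀ i, Measurable (f i)) (hf1 : ∀ i x, |f i x| ≤ 1)
    (hη0 : 0 ≤ η) (hη : ∀ i j, i ≠ j → |∫ x, f i x * f j x ∂stdGaussian (Point d)| ≤ η)
    (S : Finset ι) {h : Point d → ℝ} (hh : Measurable h) {β : ℝ} (hηβ : η ≤ β) (hβ : 2 * β ≤ 1)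
    (hS : ∀ i ∈ S, sqLoss (labelled (f i)) h ≤ ENNReal.ofReal (1 - 2 * β)) :
    S.card * β ≤ 1 := by
  rcases S.eq_empty_or_nonempty with rfl | hne
  · simp
  have hN : (0 : ℝ) < S.card := by exact_mod_cast hne.card_pos
  have hT : Measurable fun x => ∑ i ∈ S, f i x := by fun_prop
  have hTb : ∀ x, |∑ i ∈ S, f i x| ≤ S.card := fun x => by
    refine (Finset.abs_sum_le_sum_abs _ _).trans ?_
    exact (Finset.sum_le_card_nsmul _ _ 1 fun i _ => hf1 i x).trans (by simp)
  have hTs : ∀ x, (∑ i ∈ S, f i x) ^ 2 ≤ (S.card : ℝ) ^ 2 := fun x => by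
    rw [← sq_abs]; exact pow_le_pow_left₀ (abs_nonneg _) (hTb x) 2
  have hTi : Integrable (fun x => (∑ i ∈ S, f i x) ^ 2) (stdGaussian (Point d)) :=
    integrable_of_abs_le (C := (S.card : ℝ) ^ 2) (by fun_prop) fun x => by
      rw [abs_of_nonneg (sq_nonneg _)]; exact hTs x
  have h3 := integral_sq_sum_le hf hf1 hη0 hη S (c := fun _ => 1) (by simp)
  simp only [one_mul] at h3
  set N : ℝ := (S.card : ℝ)
  have hpt : ∀ x i, 0 ≤ h x ^ 2 - 2 * h x * f i x + 1 := fun x i => by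
    have := sq_le_one_iff_abs_le_one (f i x) |>.2 (hf1 i x)
    nlinarith [sq_nonneg (h x - f i x)]
  have key : ENNReal.ofReal (∫ x, (N - (∑ i ∈ S, f i x) ^ 2 * N⁻¹) ∂stdGaussian (Point d)) ≤
      ENNReal.ofReal (N * (1 - 2 * β)) := by
    rw [ofReal_integral_eq_lintegral_ofReal
      (show Integrable (fun x => N - (∑ i ∈ S, f i x) ^ 2 * N⁻¹) (stdGaussian (Point d)) from
        (integrable_const _).sub (hTi.mul_const _))]
    · calc ∫⁻ x, ENNReal.ofReal (N - (∑ i ∈ S, f i x) ^ 2 * N⁻¹) ∂stdGaussian (Point d)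
          ≤ ∫⁻ x, ∑ i ∈ S, ENNReal.ofReal (h x ^ 2 - 2 * h x * f i x + 1)
              ∂stdGaussian (Point d) := by
            refine lintegral_mono fun x => ?_
            rw [← ENNReal.ofReal_sum_of_nonneg fun i _ => hpt x i]
            refine ENNReal.ofReal_le_ofReal ?_
            simp only [Finset.sum_add_distrib, Finset.sum_sub_distrib, Finset.sum_const,
              nsmul_eq_mul, ← Finset.mul_sum, mul_one]
            change _ ≤ N * h x ^ 2 - _ + N
            set T := ∑ i ∈ S, f i x
            have : N * h x ^ 2 - 2 * h x * T + N - (N - T ^ 2 * N⁻¹) =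
                (N * h x - T) ^ 2 * N⁻¹ := by field_simp; ring
            have h0 : 0 ≤ (N * h x - T) ^ 2 * N⁻¹ := by positivity
            linarith
        _ = ∑ i ∈ S, sqLoss (labelled (f i)) h := by
            rw [lintegral_finsetSum _ fun i _ => by fun_prop]
            exact Finset.sum_congr rfl fun i _ => (sqLoss_labelled (hf i) (hf1 i) hh).symm
        _ ≤ S.card • ENNReal.ofReal (1 - 2 * β) := Finset.sum_le_card_nsmul _ _ _ hS
        _ = ENNReal.ofReal (N * (1 - 2 * β)) := by
            rw [ENNReal.ofReal_mul hN.le, ENNReal.ofReal_natCast, nsmul_eq_mul]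
    · refine .of_forall fun x => ?_
      change 0 ≤ N - _ * N⁻¹
      have : (∑ i ∈ S, f i x) ^ 2 * N⁻¹ ≤ N ^ 2 * N⁻¹ :=
        mul_le_mul_of_nonneg_right (hTs x) (by positivity)
      have e : N ^ 2 * N⁻¹ = N := by field_simp
      linarith
  rw [ENNReal.ofReal_le_ofReal_iff (mul_nonneg hN.le (by linarith)),
    integral_sub (integrable_const _) (hTi.mul_const _), integral_mul_const] at key
  simp only [integral_const, probReal_univ, smul_eq_mul, one_mul] at key
  have h4 := mul_le_mul_of_nonneg_right h3 (by positivity : 0 ≤ N⁻¹)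
  have h5 : (N + N ^ 2 * η) * N⁻¹ = 1 + N * η := by field_simp
  nlinarith

end Family

/-! ### Query transcripts and the general SQ lower bound. -/

namespace SQAlg

/-- The queries asked by a run of the algorithm. -/
def asked (O : Query d → ℝ) : SQAlg d → List (Query d)
  | output _ _ => []
  | query q next => q :: asked O (next (O q))

lemma length_asked (O : Query d → ℝ) (a : SQAlg d) : (a.asked O).length = a.numQueries O := by
  induction a with
  | output => rfl
  | query q next ih => simp [asked, numQueries, ih]

lemma run_congr {O O' : Query d → ℝ} (a : SQAlg d) (h : ∀ q ∈ a.asked O, O' q = O q) :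
    a.run O' = a.run O := by
  induction a with
  | output => rfl
  | query q next ih =>
    simp only [asked, List.mem_cons, forall_eq_or_imp] at h
    simp only [run, h.1]
    exact ih _ h.2

lemma measurable_run (O : Query d → ℝ) (a : SQAlg d) : Measurable (a.run O) := by
  induction a with
  | output h hh => exact hh
  | query q next ih => exact ih _

end SQAlg

open Classical in
lemma card_filter_exists_mem_le {ι α : Type*} [Fintype ι] (P : α → ι → Prop) {B : ℝ} (l : List α)
    (h : ∀ a, ((Finset.univ.filter (P a)).card : ℝ) ≤ B) :
    ((Finset.univ.filter fun i => ∃ a ∈ l, P a i).card : ℝ) ≤ l.length * B := by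
  induction l with
  | nil => simp
  | cons a l ih =>
    have : (Finset.univ.filter fun i => ∃ b ∈ a :: l, P b i) =
        Finset.univ.filter (P a) ∪ Finset.univ.filter fun i => ∃ b ∈ l, P b i := by
      ext i; simp
    rw [this]
    have h1 : ((Finset.univ.filter (P a) ∪ Finset.univ.filter fun i => ∃ b ∈ l, P b i).card : ℝ) ≤
        (Finset.univ.filter (P a)).card + (Finset.univ.filter fun i => ∃ b ∈ l, P b i).card := by
      exact_mod_cast Finset.card_union_le _ _
    push_cast [List.length_cons]
    linarith [h a]

/-- A family of nearly uncorrelated functions that can all be noticeably approximated by a ReLU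
forces an SQ learner to ask many queries. -/
theorem RandSQAlg.card_le {ι : Type*} [Fintype ι] {f : ι → Point d → ℝ} {η τ β ε : ℝ}
    (hf : ∀ i, Measurable (f i)) (hf1 : ∀ i x, |f i x| ≤ 1) (hη0 : 0 ≤ η)
    (hη : ∀ i j, i ≠ j → |∫ x, f i x * f j x ∂stdGaussian (Point d)| ≤ η)
    (hτ : 0 < τ) (hητ : 2 * η ≤ τ ^ 2) (hβ0 : 0 < β) (hηβ : η ≤ β) (hβ : 2 * β ≤ 1)
    (hopt : ∀ i, opt (labelled (f i)) + ENNReal.ofReal ε ≤ ENNReal.ofReal (1 - 2 * β))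
    {A : RandSQAlg d} {n : ℕ} (hA : A.QueriesAtMost τ n) (hL : A.Learns τ ε) :
    2 / 3 * (Fintype.card ι : ℝ) ≤ n * (2 / τ ^ 2) + 1 / β := by
  classical
  let E : ι → Query d → ℝ := fun i q => ∫ p, q.toFun p ∂labelled (f i)
  let E₀ : Query d → ℝ := fun q => ∫ p, q.toFun p ∂labelled fun _ : Point d => 0
  -- The adversarial oracle: it answers as for the null distribution unless the tolerance forbids
  -- it.
  let O : ι → Query d → ℝ := fun i q => if τ < |E i q - E₀ q| then E i q else E₀ q
  have hO : ∀ i, IsSTAT τ (labelled (f i)) (O i) := fun i q => by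
    change |(if τ < |E i q - E₀ q| then E i q else E₀ q) - E i q| ≤ τ
    split_ifs with h
    · simpa using hτ.le
    · rw [abs_sub_comm]; exact not_lt.1 h
  have hO₀ : IsSTAT τ (labelled fun _ : Point d => 0) E₀ := fun q => by simpa [E₀] using hτ.le
  have hbad : ∀ q, ((Finset.univ.filter fun i => τ < |E i q - E₀ q|).card : ℝ) ≤ 2 / τ ^ 2 := by
    intro q
    have hq := q.measurable
    rw [le_div_iff₀ (by positivity)]
    refine card_mul_sq_le_of_correlated hf hf1 hη0 hη _
      (g := fun x => (q.toFun (x, 1) - q.toFun (x, -1)) / 2) (by fun_prop) (fun x => ?_) hτ hητ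
      fun i hi => ?_
    · have h1 := q.mem_Icc (x, 1)
      have h2 := q.mem_Icc (x, -1)
      rw [abs_le]; constructor <;> linarith [h1.1, h1.2, h2.1, h2.2]
    · rw [← integral_labelled_sub (hf i) (hf1 i) q]
      exact (Finset.mem_filter.1 hi).2
  choose G hGm hGp hG using fun i => hL _ (labelled_instance (hf i) (hf1 i)) (O i) (hO i)
  -- For a fixed seed, compare with the run against `E₀`. An instance on which the seed succeeds
  -- either is exposed by a query of that one run, or shares its output hypothesis, which must then
  -- be good for it.
  have hcount : ∀ ω, ((Finset.univ.filter fun i => ω ∈ G i).card : ℝ) ≤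
      n * (2 / τ ^ 2) + 1 / β := by
    intro ω
    let l := (A.alg ω).asked E₀
    have hl : (l.length : ℝ) ≤ n := by
      rw [SQAlg.length_asked]
      exact_mod_cast hA _ (labelled_instance measurable_const (by simp)) E₀ hO₀ ω
    have h1 := card_filter_exists_mem_le (fun q i => τ < |E i q - E₀ q|) l hbad
    have h2 : ((Finset.univ.filter fun i => sqLoss (labelled (f i)) ((A.alg ω).run E₀) ≤
        ENNReal.ofReal (1 - 2 * β)).card : ℝ) ≤ 1 / β := by
      rw [le_div_iff₀ hβ0]
      exact card_mul_le_of_sqLoss_le hf hf1 hη0 hη _ (SQAlg.measurable_run _ _) hηβ hβ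
        fun i hi => (Finset.mem_filter.1 hi).2
    have hsub : (Finset.univ.filter fun i => ω ∈ G i) ⊆
        (Finset.univ.filter fun i => ∃ q ∈ l, τ < |E i q - E₀ q|) ∪
        Finset.univ.filter fun i => sqLoss (labelled (f i)) ((A.alg ω).run E₀) ≤
          ENNReal.ofReal (1 - 2 * β) := by
      intro i hi
      simp only [Finset.mem_union, Finset.mem_filter, Finset.mem_univ, true_and] at hi ⊢
      by_contra! hcon
      have hrun : (A.alg ω).run (O i) = (A.alg ω).run E₀ :=
        SQAlg.run_congr _ fun q hq => if_neg (not_lt.2 (hcon.1 q hq))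
      have := (hG i ω hi).trans (hopt i)
      rw [hrun] at this
      exact absurd this (not_le.2 hcon.2)
    have h3 : ((Finset.univ.filter fun i => ω ∈ G i).card : ℝ) ≤ _ :=
      Nat.cast_le.2 ((Finset.card_le_card hsub).trans (Finset.card_union_le _ _))
    push_cast at h3
    have h4 : (l.length : ℝ) * (2 / τ ^ 2) ≤ n * (2 / τ ^ 2) := by gcongr
    linarith
  let _ := A.measurableSpace
  have := A.isProbabilityMeasure
  -- Double counting of pairs (seed, instance): the per-seed bound is averaged over seeds, and then
  -- compared with success probability `2/3` per instance.
  have hsum : ∑ i, A.law (G i) ≤ ENNReal.ofReal (n * (2 / τ ^ 2) + 1 / β) := by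
    calc ∑ i, A.law (G i) = ∑ i, ∫⁻ ω, (G i).indicator 1 ω ∂A.law :=
          Finset.sum_congr rfl fun i _ => (lintegral_indicator_one (hGm i)).symm
      _ = ∫⁻ ω, ∑ i, (G i).indicator 1 ω ∂A.law :=
          (lintegral_finsetSum _ fun i _ => measurable_one.indicator (hGm i)).symm
      _ ≤ ∫⁻ _, ENNReal.ofReal (n * (2 / τ ^ 2) + 1 / β) ∂A.law := by
          refine lintegral_mono fun ω => ?_
          have : ∑ i, (G i).indicator (1 : A.Seed → ℝ≥0∞) ω =
              ENNReal.ofReal ((Finset.univ.filter fun i => ω ∈ G i).card : ℝ) := by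
            simp [Set.indicator_apply]
          rw [this]
          exact ENNReal.ofReal_le_ofReal (hcount ω)
      _ = _ := by simp
  have hlow : ENNReal.ofReal (2 / 3 * (Fintype.card ι : ℝ)) ≤ ∑ i, A.law (G i) := by
    have : ENNReal.ofReal (2 / 3 * (Fintype.card ι : ℝ)) = ∑ _i : ι, (2 / 3 : ℝ≥0∞) := by
      rw [Finset.sum_const, nsmul_eq_mul, mul_comm, ENNReal.ofReal_mul (by positivity),
        ENNReal.ofReal_natCast, ENNReal.ofReal_div_of_pos (by norm_num)]
      simp
    rw [this]
    exact Finset.sum_le_sum fun i _ => hGp i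
  exact (ENNReal.ofReal_le_ofReal_iff (by positivity)).1 (hlow.trans hsum)

end Labelled

/-! ### The Chebyshev wave: orthogonality to polynomials, correlation with ReLU. -/

/-- `√(1 - x²) U_{n-1}(x)` on `[-1, 1]`, extended by zero. -/
noncomputable def chebWave (n : ℕ) (x : ℝ) : ℝ := Real.sin (n * Real.arccos x)

lemma continuous_chebWave (n : ℕ) : Continuous (chebWave n) := by
  unfold chebWave; fun_prop

lemma abs_chebWave_le (n : ℕ) (x : ℝ) : |chebWave n x| ≤ 1 := Real.abs_sin_le_one _

/-- `Real.arccos` takes the constant values `π` and `0` beyond `-1` and `1`, and `sin (n ·)`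
vanishes at both. -/
lemma chebWave_eq_zero (n : ℕ) {x : ℝ} (hx : x ∉ Set.Ioc (-1 : ℝ) 1) : chebWave n x = 0 := by
  rw [Set.mem_Ioc, not_and_or, not_lt, not_le] at hx
  rcases hx with hx | hx
  · rw [chebWave, Real.arccos_of_le_neg_one hx]; exact Real.sin_nat_mul_pi n
  · simp [chebWave, Real.arccos_of_one_le hx.le]

lemma chebWave_cos (n : ℕ) {t : ℝ} (h0 : 0 ≤ t) (h1 : t ≤ Real.pi) :
    chebWave n (Real.cos t) = Real.sin (n * t) := by
  rw [chebWave, Real.arccos_cos h0 h1]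

lemma integral_chebWave_mul (n : ℕ) (g : ℝ → ℝ) :
    ∫ x, chebWave n x * g x = ∫ x in (-1 : ℝ)..1, chebWave n x * g x := by
  rw [intervalIntegral.integral_of_le (by norm_num), setIntegral_eq_integral_of_forall_compl_eq_zero]
  intro x hx
  rw [chebWave_eq_zero n hx, zero_mul]

lemma intervalIntegral_chebWave_mul (n : ℕ) {g : ℝ → ℝ} (hg : Continuous g) {b : ℝ}
    (hb : 0 ≤ b) (hb' : b ≤ Real.pi) :
    ∫ x in Real.cos b..1, chebWave n x * g x =
      ∫ t in (0 : ℝ)..b, Real.sin (n * t) * g (Real.cos t) * Real.sin t := by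
  have h := intervalIntegral.integral_comp_mul_deriv (a := 0) (b := b) (f := Real.cos)
    (f' := fun t => -Real.sin t) (g := fun x => chebWave n x * g x)
    (fun x _ => Real.hasDerivAt_cos x) (by fun_prop) ((continuous_chebWave n).mul hg)
  rw [Real.cos_zero] at h
  rw [intervalIntegral.integral_symm, ← h, ← intervalIntegral.integral_neg]
  refine intervalIntegral.integral_congr fun t ht => ?_
  rw [Set.uIcc_of_le hb] at ht
  simp only [Function.comp]
  rw [chebWave_cos n ht.1 (ht.2.trans hb')]
  ring

/-- Each factor `cos t` splits `sin (n t)` into the frequencies `n ± 1`, so `n` varies in the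
induction on `j`. -/
lemma integral_sin_mul_cos_pow_mul_sin (j : ℕ) : ∀ n : ℕ, j + 1 < n →
    ∫ t in (0 : ℝ)..Real.pi, Real.sin (n * t) * Real.cos t ^ j * Real.sin t = 0 := by
  induction j with
  | zero =>
    intro n hn
    have hn1 : ((n : ℝ) - 1) ≠ 0 := by
      have : (1 : ℝ) < n := by exact_mod_cast (by omega : 1 < n)
      linarith
    have hn2 : ((n : ℝ) + 1) ≠ 0 := by positivity
    rw [intervalIntegral.integral_eq_sub_of_hasDerivAt
      (f := fun t => Real.sin ((n - 1) * t) / (2 * (n - 1)) - Real.sin ((n + 1) * t) / (2 * (n + 1)))]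
    · have e1 : Real.sin (((n : ℝ) - 1) * Real.pi) = 0 := by
        have := Real.sin_int_mul_pi ((n : ℤ) - 1)
        push_cast at this; exact this
      have e2 : Real.sin (((n : ℝ) + 1) * Real.pi) = 0 := by
        have := Real.sin_int_mul_pi ((n : ℤ) + 1)
        push_cast at this; exact this
      simp [e1, e2]
    · intro t _
      have d1 : HasDerivAt (fun t : ℝ => Real.sin ((n - 1) * t))
          (Real.cos ((n - 1) * t) * ((n - 1) * 1)) t := ((hasDerivAt_id t).const_mul _).sin
      have d2 : HasDerivAt (fun t : ℝ => Real.sin ((n + 1) * t))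
          (Real.cos ((n + 1) * t) * ((n + 1) * 1)) t := ((hasDerivAt_id t).const_mul _).sin
      refine ((d1.div_const (2 * ((n : ℝ) - 1))).sub
        (d2.div_const (2 * ((n : ℝ) + 1)))).congr_deriv ?_
      have c1 : Real.cos (((n : ℝ) - 1) * t) =
          Real.cos (n * t) * Real.cos t + Real.sin (n * t) * Real.sin t := by
        rw [sub_mul, one_mul, Real.cos_sub]
      have c2 : Real.cos (((n : ℝ) + 1) * t) =
          Real.cos (n * t) * Real.cos t - Real.sin (n * t) * Real.sin t := by
        rw [add_mul, one_mul, Real.cos_add]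
      rw [c1, c2]
      field_simp
      ring
    · exact (by fun_prop : Continuous _).intervalIntegrable _ _
  | succ j ih =>
    intro n hn
    have h1 := ih (n + 1) (by omega)
    have h2 := ih (n - 1) (by omega)
    rw [Nat.cast_sub (by omega)] at h2
    push_cast at h1 h2
    have : ∀ t : ℝ, Real.sin (n * t) * Real.cos t ^ (j + 1) * Real.sin t =
        (Real.sin ((n + 1) * t) * Real.cos t ^ j * Real.sin t +
          Real.sin ((n - 1) * t) * Real.cos t ^ j * Real.sin t) * (1 / 2) := by
      intro t
      rw [add_mul (n : ℝ), sub_mul, one_mul, Real.sin_add, Real.sin_sub]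
      ring
    simp_rw [this]
    rw [intervalIntegral.integral_mul_const, intervalIntegral.integral_add
      ((by fun_prop : Continuous _).intervalIntegrable _ _)
      ((by fun_prop : Continuous _).intervalIntegrable _ _), h1, h2]
    simp

lemma integral_chebWave_mul_pow {n j : ℕ} (h : j + 1 < n) : ∫ x, chebWave n x * x ^ j = 0 := by
  rw [integral_chebWave_mul, ← Real.cos_pi, intervalIntegral_chebWave_mul n (by fun_prop)
    Real.pi_pos.le le_rfl, integral_sin_mul_cos_pow_mul_sin j n h]

lemma hasCompactSupport_chebWave (n : ℕ) : HasCompactSupport (chebWave n) :=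
  HasCompactSupport.intro (isCompact_Icc (a := (-1 : ℝ)) (b := 1)) fun _ hx =>
    chebWave_eq_zero n fun h => hx (Set.Ioc_subset_Icc_self h)

lemma integrable_chebWave_mul (n : ℕ) {g : ℝ → ℝ} (hg : Continuous g) :
    Integrable fun x => chebWave n x * g x :=
  ((continuous_chebWave n).mul hg).integrable_of_hasCompactSupport
    (hasCompactSupport_chebWave n).mul_right

lemma integral_chebWave_mul_eval {n : ℕ} {p : Polynomial ℝ} (h : p.natDegree + 1 < n) :
    ∫ x, chebWave n x * p.eval x = 0 := by
  simp_rw [Polynomial.eval_eq_sum_range, Finset.mul_sum]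
  rw [integral_finsetSum _ fun i _ => integrable_chebWave_mul n (by fun_prop)]
  refine Finset.sum_eq_zero fun i hi => ?_
  simp_rw [mul_left_comm _ (p.coeff i)]
  rw [integral_const_mul, integral_chebWave_mul_pow (by
    have := Finset.mem_range.1 hi; omega), mul_zero]

lemma abs_integral_chebWave_mul_le (n : ℕ) {g : ℝ → ℝ} {C : ℝ}
    (hC : ∀ x ∈ Set.Icc (-1 : ℝ) 1, |g x| ≤ C) : |∫ x, chebWave n x * g x| ≤ 2 * C := by
  rw [integral_chebWave_mul]
  have := intervalIntegral.norm_integral_le_of_norm_le_const (a := -1) (b := 1) (C := C)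
    (f := fun x => chebWave n x * g x) fun x hx => by
      rw [Set.uIoc_of_le (by norm_num)] at hx
      rw [Real.norm_eq_abs, abs_mul]
      exact (mul_le_of_le_one_left (abs_nonneg _) (abs_chebWave_le n x)).trans
        (hC x (Set.Ioc_subset_Icc_self hx))
  rw [Real.norm_eq_abs] at this
  refine this.trans (le_of_eq ?_)
  norm_num; ring

/-- The wave is almost orthogonal to `exp ∘ z` for a small quadratic polynomial `z`. -/
lemma abs_integral_chebWave_mul_exp_le {m n : ℕ} (hm : 0 < m) (hmn : 2 * m ≤ n)
    (p : Polynomial ℝ) (hp : p.natDegree ≤ 2) {r : ℝ} (hr : r ≤ 1)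
    (hpr : ∀ x ∈ Set.Icc (-1 : ℝ) 1, |p.eval x| ≤ r) :
    |∫ x, chebWave n x * Real.exp (p.eval x)| ≤ 4 * r ^ m := by
  -- The first `m` terms of the exponential series have degree at most `2(m - 1)` in `x` and are
  -- invisible to the wave; only the tail of size `2 r ^ m` remains.
  let T : Polynomial ℝ := ∑ k ∈ Finset.range m, Polynomial.C ((k.factorial : ℝ)⁻¹) * p ^ k
  have hT : T.natDegree + 1 < n := by
    have : T.natDegree ≤ 2 * (m - 1) := by
      refine Polynomial.natDegree_sum_le_of_forall_le _ _ fun k hk => ?_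
      refine (Polynomial.natDegree_C_mul_le _ _).trans (Polynomial.natDegree_pow_le.trans ?_)
      have := Finset.mem_range.1 hk
      calc k * p.natDegree ≤ k * 2 := Nat.mul_le_mul_left _ hp
        _ ≤ _ := by omega
    omega
  have hTe : ∀ x, T.eval x = ∑ k ∈ Finset.range m, p.eval x ^ k / k.factorial := fun x => by
    simp only [T, Polynomial.eval_finsetSum, Polynomial.eval_mul, Polynomial.eval_C,
      Polynomial.eval_pow]
    exact Finset.sum_congr rfl fun k _ => by rw [div_eq_mul_inv, mul_comm]
  have h0 := integral_chebWave_mul_eval hT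
  have h1 : ∫ x, chebWave n x * Real.exp (p.eval x) =
      ∫ x, chebWave n x * (Real.exp (p.eval x) - T.eval x) := by
    simp_rw [mul_sub]
    rw [integral_sub (integrable_chebWave_mul n (by fun_prop))
      (integrable_chebWave_mul n (by fun_prop)), h0, sub_zero]
  rw [h1]
  refine (abs_integral_chebWave_mul_le n (C := 2 * r ^ m) fun x hx => ?_).trans (by linarith)
  rw [hTe]
  refine (Real.exp_bound ((hpr x hx).trans hr) hm).trans ?_
  have hf : ((m.succ : ℝ) / (m.factorial * m)) ≤ 2 := by
    have hm' : (1 : ℝ) ≤ m := by exact_mod_cast hm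
    have hfac : (1 : ℝ) ≤ m.factorial := by exact_mod_cast m.factorial_pos
    rw [div_le_iff₀ (by positivity)]
    push_cast
    nlinarith
  calc |p.eval x| ^ m * ((m.succ : ℝ) / (m.factorial * m)) ≤ r ^ m * 2 :=
        mul_le_mul (pow_le_pow_left₀ (abs_nonneg _) (hpr x hx) m) hf (by positivity)
          (pow_nonneg ((abs_nonneg _).trans (hpr x hx)) m)
    _ = 2 * r ^ m := mul_comm _ _

lemma relu_eq_zero {x : ℝ} (hx : x ≤ 0) : relu x = 0 := max_eq_left hx

lemma relu_of_nonneg {x : ℝ} (hx : 0 ≤ x) : relu x = x := max_eq_right hx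

lemma continuous_relu : Continuous relu := continuous_const.max continuous_id

/-- After `x = cos t` only `[0, π/2]` counts, and the integrand is a quarter of `cos ((2m-1)t) - cos
((2m+3)t)`. An odd frequency is needed: both primitives vanish at `π/2` for even frequencies above
`2`. -/
lemma integral_chebWave_mul_relu {m : ℕ} (hm : 0 < m) :
    ∫ x, chebWave (2 * m + 1) x * relu x =
      (-1) ^ (m + 1) / ((2 * m - 1) * (2 * m + 3)) := by
  have hm' : (1 : ℝ) ≤ m := by exact_mod_cast hm
  have hn1 : (2 * (m : ℝ) - 1) ≠ 0 := by linarith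
  have hn2 : (2 * (m : ℝ) + 3) ≠ 0 := by linarith
  have hc : Continuous fun x => chebWave (2 * m + 1) x * relu x :=
    (continuous_chebWave _).mul continuous_relu
  rw [integral_chebWave_mul, ← intervalIntegral.integral_add_adjacent_intervals (b := 0)
    (hc.intervalIntegrable _ _) (hc.intervalIntegrable _ _)]
  have hneg : ∫ x in (-1 : ℝ)..0, chebWave (2 * m + 1) x * relu x = 0 := by
    rw [intervalIntegral.integral_congr (g := fun _ => 0)]
    · simp
    · intro x hx
      rw [Set.uIcc_of_le (by norm_num)] at hx
      simp [relu_eq_zero hx.2]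
  rw [hneg, zero_add, ← Real.cos_pi_div_two, intervalIntegral_chebWave_mul _ continuous_relu
    (by positivity) (by linarith [Real.pi_pos])]
  rw [intervalIntegral.integral_congr
    (g := fun t => Real.sin ((2 * m + 1) * t) * Real.cos t * Real.sin t)]
  swap
  · intro t ht
    rw [Set.uIcc_of_le (by positivity)] at ht
    have : 0 ≤ Real.cos t := Real.cos_nonneg_of_mem_Icc ⟨by linarith [ht.1, Real.pi_pos], ht.2⟩
    simp [relu_of_nonneg this]
  rw [intervalIntegral.integral_eq_sub_of_hasDerivAt
      (f := fun t => Real.sin ((2 * m - 1) * t) / (4 * (2 * m - 1)) -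
        Real.sin ((2 * m + 3) * t) / (4 * (2 * m + 3)))]
  · have e1 : Real.sin ((2 * (m : ℝ) - 1) * (Real.pi / 2)) = (-1) ^ (m + 1) := by
      rw [show (2 * (m : ℝ) - 1) * (Real.pi / 2) = m * Real.pi - Real.pi / 2 by ring,
        Real.sin_sub_pi_div_two, Real.cos_nat_mul_pi]
      ring
    have e2 : Real.sin ((2 * (m : ℝ) + 3) * (Real.pi / 2)) = (-1) ^ (m + 1) := by
      rw [show (2 * (m : ℝ) + 3) * (Real.pi / 2) = (m + 1 : ℕ) * Real.pi + Real.pi / 2 by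
        push_cast; ring, Real.sin_add_pi_div_two, Real.cos_nat_mul_pi]
    simp only [e1, e2, mul_zero, Real.sin_zero, zero_div, sub_zero]
    field_simp
    ring
  · intro t _
    have d1 : HasDerivAt (fun t : ℝ => Real.sin ((2 * m - 1) * t))
        (Real.cos ((2 * m - 1) * t) * ((2 * m - 1) * 1)) t := ((hasDerivAt_id t).const_mul _).sin
    have d2 : HasDerivAt (fun t : ℝ => Real.sin ((2 * m + 3) * t))
        (Real.cos ((2 * m + 3) * t) * ((2 * m + 3) * 1)) t := ((hasDerivAt_id t).const_mul _).sin
    refine ((d1.div_const (4 * (2 * (m : ℝ) - 1))).sub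
      (d2.div_const (4 * (2 * (m : ℝ) + 3)))).congr_deriv ?_
    have c1 : Real.cos ((2 * (m : ℝ) - 1) * t) = Real.cos ((2 * m + 1) * t) * Real.cos (2 * t) +
        Real.sin ((2 * m + 1) * t) * Real.sin (2 * t) := by
      rw [← Real.cos_sub]; ring_nf
    have c2 : Real.cos ((2 * (m : ℝ) + 3) * t) = Real.cos ((2 * m + 1) * t) * Real.cos (2 * t) -
        Real.sin ((2 * m + 1) * t) * Real.sin (2 * t) := by
      rw [← Real.cos_add]; ring_nf
    rw [c1, c2, Real.sin_two_mul]
    field_simp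
    ring
  · exact (by fun_prop : Continuous _).intervalIntegrable _ _

/-! ### Two projections of a Gaussian vector. -/

section GaussianVectors

variable {d : ℕ}

lemma covariance_inner_stdGaussian (u v : Point d) :
    cov[fun x => inner ℝ u x, fun x => inner ℝ v x; stdGaussian (Point d)] = inner ℝ u v := by
  rw [← covarianceBilin_apply_eq_cov IsGaussian.memLp_two_id, covarianceBilin_stdGaussian]
  rfl

lemma map_inner_stdGaussian (u : Point d) :
    (stdGaussian (Point d)).map (fun x => inner ℝ u x) = gaussianReal 0 (‖u‖ ^ 2).toNNReal := by
  have h := IsGaussian.map_eq_gaussianReal (μ := stdGaussian (Point d)) (innerSL ℝ u)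
  rw [integral_strongDual_stdGaussian, variance_dual_stdGaussian, innerSL_apply_norm] at h
  exact h

lemma map_inner_prod_stdGaussian {u w : Point d} (h : inner ℝ u w = 0) :
    (stdGaussian (Point d)).map (fun x => (inner ℝ u x, inner ℝ w x)) =
      (gaussianReal 0 (‖u‖ ^ 2).toNNReal).prod (gaussianReal 0 (‖w‖ ^ 2).toNNReal) := by
  have hlaw : HasGaussianLaw (fun x : Point d => ((inner ℝ u x : ℝ), (inner ℝ w x : ℝ)))
      (stdGaussian (Point d)) :=
    (IsGaussian.hasGaussianLaw_id (μ := stdGaussian (Point d))).map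
      ((innerSL ℝ u).prod (innerSL ℝ w))
  have hind := hlaw.indepFun_of_covariance_eq_zero (by rw [covariance_inner_stdGaussian, h])
  rw [(indepFun_iff_map_prod_eq_prod_map_map (by fun_prop) (by fun_prop)).1 hind,
    map_inner_stdGaussian, map_inner_stdGaussian]

/-- Write `v = ρ u + w` with `w ⊥ u`. The projections on `u` and `w` are jointly Gaussian and
uncorrelated, hence independent. -/
lemma integral_inner_mul_inner_stdGaussian {u v : Point d} (hu : ‖u‖ = 1) (hv : ‖v‖ = 1)
    {f g : ℝ → ℝ} (hf : Measurable f) (hg : Measurable g) (hf1 : ∀ x, |f x| ≤ 1)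
    (hg1 : ∀ x, |g x| ≤ 1) :
    ∫ x, f (inner ℝ u x) * g (inner ℝ v x) ∂stdGaussian (Point d) =
      ∫ x, f x * ∫ y, g y ∂gaussianReal (inner ℝ u v * x) (1 - inner ℝ u v ^ 2).toNNReal
        ∂gaussianReal 0 1 := by
  set ρ : ℝ := inner ℝ u v with hρ
  let w := v - ρ • u
  have huw : inner ℝ u w = 0 := by
    simp [w, inner_sub_right, inner_smul_right, ← hρ, hu]
  have hw : ‖w‖ ^ 2 = 1 - ρ ^ 2 := by
    rw [norm_sub_sq_real, inner_smul_right, norm_smul, real_inner_comm, ← hρ, hu, hv, mul_one,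
      Real.norm_eq_abs, sq_abs]
    ring
  have hvx : ∀ x : Point d, inner ℝ v x = ρ * inner ℝ u x + inner ℝ w x := fun x => by
    simp [w, inner_sub_left, inner_smul_left]
  have hmap := map_inner_prod_stdGaussian huw
  rw [hu, hw, one_pow, Real.toNNReal_one] at hmap
  have hm : Measurable fun p : ℝ × ℝ => f p.1 * g (ρ * p.1 + p.2) := by fun_prop
  simp_rw [hvx]
  have e : ∫ x, f (inner ℝ u x) * g (ρ * inner ℝ u x + inner ℝ w x) ∂stdGaussian (Point d) =
      ∫ p, f p.1 * g (ρ * p.1 + p.2) ∂(stdGaussian (Point d)).map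
        (fun x => ((inner ℝ u x : ℝ), (inner ℝ w x : ℝ))) := by
    rw [integral_map (by fun_prop) hm.aestronglyMeasurable]
  rw [e, hmap, integral_prod _ (integrable_of_abs_le (C := 1) hm fun p => by
    rw [abs_mul]; exact mul_le_one₀ (hf1 _) (abs_nonneg _) (hg1 _))]
  refine integral_congr_ae (.of_forall fun x => ?_)
  simp only
  rw [integral_const_mul, ← zero_add (ρ * x), ← gaussianReal_map_const_add,
    integral_map (by fun_prop) hg.aestronglyMeasurable, zero_add]

end GaussianVectors

/-! ### The hidden-direction wave under the Gaussian measure. -/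

/-- A bounded function whose product with the Gaussian density is a multiple of `chebWave`. -/
noncomputable def gaussWave (m : ℕ) (x : ℝ) : ℝ :=
  (-1) ^ (m + 1) * (chebWave (2 * m + 1) x * Real.exp ((x ^ 2 - 1) / 2))

lemma continuous_gaussWave (m : ℕ) : Continuous (gaussWave m) :=
  continuous_const.mul ((continuous_chebWave _).mul (by fun_prop))

lemma gaussWave_eq_zero (m : ℕ) {x : ℝ} (hx : x ∉ Set.Icc (-1 : ℝ) 1) : gaussWave m x = 0 := by
  rw [gaussWave, chebWave_eq_zero _ fun h => hx (Set.Ioc_subset_Icc_self h)]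
  simp

lemma abs_gaussWave_le (m : ℕ) (x : ℝ) : |gaussWave m x| ≤ 1 := by
  by_cases hx : x ∈ Set.Icc (-1 : ℝ) 1
  · rw [gaussWave, abs_mul, abs_pow, abs_neg, abs_one, one_pow, one_mul, abs_mul, Real.abs_exp]
    refine mul_le_one₀ (abs_chebWave_le _ _) (Real.exp_pos _).le (Real.exp_le_one_iff.2 ?_)
    nlinarith [hx.1, hx.2]
  · simp [gaussWave_eq_zero m hx]

/-- The value at `1` of the standard Gaussian density. -/
noncomputable def densityOne : ℝ := (√(2 * Real.pi))⁻¹ * Real.exp (-1 / 2)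

lemma densityOne_pos : 0 < densityOne := by
  have := Real.pi_pos
  unfold densityOne; positivity

lemma densityOne_le_one : densityOne ≤ 1 := by
  refine mul_le_one₀ (inv_le_one_of_one_le₀ ?_) (Real.exp_pos _).le
    (Real.exp_le_one_iff.2 (by norm_num))
  rw [Real.one_le_sqrt]
  linarith [Real.pi_gt_three]

lemma gaussianPDFReal_mul_gaussWave (m : ℕ) (x : ℝ) :
    gaussianPDFReal 0 1 x * gaussWave m x =
      (-1) ^ (m + 1) * densityOne * chebWave (2 * m + 1) x := by
  have : Real.exp (-1 / 2) = Real.exp (-x ^ 2 / 2) * Real.exp ((x ^ 2 - 1) / 2) := by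
    rw [← Real.exp_add]; ring_nf
  rw [gaussianPDFReal, gaussWave, densityOne, this]
  simp only [NNReal.coe_one, mul_one, sub_zero]
  ring

/-- For fixed `y`, the integral over `x` is that of the Chebyshev wave against a factor `exp (z y)`,
with `z y` a quadratic polynomial of size at most `2ρ` on `[-1, 1]`. Orthogonality in `x` alone
suffices. -/
lemma abs_integral_gaussWave_le {m : ℕ} (hm : 0 < m) {ρ : ℝ} (h0 : 0 ≤ ρ) (h1 : ρ ≤ 1 / 4) :
    |∫ x, gaussWave m x * ∫ y, gaussWave m y ∂gaussianReal (ρ * x) (1 - ρ ^ 2).toNNReal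
      ∂gaussianReal 0 1| ≤ 4 * (2 * ρ) ^ m := by
  have hs0 : (0 : ℝ) < 1 - ρ ^ 2 := by nlinarith
  set s : NNReal := (1 - ρ ^ 2).toNNReal with hs
  have hsc : (s : ℝ) = 1 - ρ ^ 2 := Real.coe_toNNReal _ hs0.le
  have hsne : s ≠ 0 := by
    rw [hs]; exact (Real.toNNReal_pos.2 hs0).ne'
  let K : ℝ → ℝ → ℝ := fun x y =>
    (gaussianPDFReal 0 1 x * gaussWave m x) * (gaussianPDFReal (ρ * x) s y * gaussWave m y)
  have hKc : Continuous (Function.uncurry K) := by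
    have := continuous_gaussWave m
    have hx : Continuous fun p : ℝ × ℝ => gaussWave m p.1 := this.comp continuous_fst
    have hy : Continuous fun p : ℝ × ℝ => gaussWave m p.2 := this.comp continuous_snd
    simp only [K, Function.uncurry_def, gaussianPDFReal]
    fun_prop
  have hKs : HasCompactSupport (Function.uncurry K) := by
    refine HasCompactSupport.intro ((isCompact_Icc (a := (-1 : ℝ)) (b := 1)).prod
      (isCompact_Icc (a := (-1 : ℝ)) (b := 1))) fun p hp => ?_
    rw [Set.mem_prod, not_and_or] at hp
    rcases hp with hp | hp <;> simp [Function.uncurry, K, gaussWave_eq_zero m hp]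
  -- The logarithm of the ratio at `y` of the Gaussian densities with means `ρ x` and `0`, as a
  -- polynomial in `x`.
  let z : ℝ → Polynomial ℝ := fun y =>
    Polynomial.C (-ρ ^ 2 / (2 * s)) * Polynomial.X ^ 2 + Polynomial.C (ρ * y / s) * Polynomial.X
  have hz : ∀ y, (z y).natDegree ≤ 2 := fun y => by
    refine (Polynomial.natDegree_add_le _ _).trans (max_le ?_ ?_)
    · exact Polynomial.natDegree_C_mul_X_pow_le _ _
    · exact (Polynomial.natDegree_C_mul_le _ _).trans (Polynomial.natDegree_X_le.trans one_le_two)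
  have hze : ∀ y x, (z y).eval x = (2 * ρ * x * y - ρ ^ 2 * x ^ 2) / (2 * s) := fun y x => by
    simp only [z, Polynomial.eval_add, Polynomial.eval_mul, Polynomial.eval_C, Polynomial.eval_pow,
      Polynomial.eval_X]
    have : (s : ℝ) ≠ 0 := by rw [hsc]; exact hs0.ne'
    field_simp
    ring
  have hzb : ∀ y ∈ Set.Icc (-1 : ℝ) 1, ∀ x ∈ Set.Icc (-1 : ℝ) 1, |(z y).eval x| ≤ 2 * ρ := by
    intro y hy x hx
    rw [hze, hsc, abs_div, abs_of_pos (by linarith : (0 : ℝ) < 2 * (1 - ρ ^ 2)),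
      div_le_iff₀ (by linarith)]
    have hxy : |x * y| ≤ 1 := by
      rw [abs_mul]; exact mul_le_one₀ (abs_le.2 hx) (abs_nonneg _) (abs_le.2 hy)
    have hx2 : x ^ 2 ≤ 1 := (sq_le_one_iff_abs_le_one x).2 (abs_le.2 hx)
    calc |2 * ρ * x * y - ρ ^ 2 * x ^ 2| ≤ |2 * ρ * (x * y)| + |ρ ^ 2 * x ^ 2| := by
          rw [← mul_assoc]; exact abs_sub _ _
      _ ≤ 2 * ρ * 1 + ρ ^ 2 * 1 := by
          rw [abs_mul, abs_of_nonneg (by positivity : 0 ≤ 2 * ρ),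
            abs_of_nonneg (by positivity : 0 ≤ ρ ^ 2 * x ^ 2)]
          gcongr
      _ ≤ 2 * ρ * (2 * (1 - ρ ^ 2)) := by nlinarith [mul_nonneg h0 h0]
  have hKe : ∀ x y, K x y = gaussianPDFReal 0 s y * (gaussWave m y * ((-1) ^ (m + 1) * densityOne)) *
      (chebWave (2 * m + 1) x * Real.exp ((z y).eval x)) := by
    intro x y
    have he : Real.exp (-(y - ρ * x) ^ 2 / (2 * s)) =
        Real.exp (-(y - 0) ^ 2 / (2 * s)) * Real.exp ((z y).eval x) := by
      rw [← Real.exp_add, hze]; ring_nf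
    simp only [K, gaussianPDFReal_mul_gaussWave]
    rw [gaussianPDFReal, gaussianPDFReal, he]
    ring
  rw [integral_gaussianReal_eq_integral_smul one_ne_zero]
  have e1 : ∀ x, gaussianPDFReal 0 1 x • (gaussWave m x *
      ∫ y, gaussWave m y ∂gaussianReal (ρ * x) s) = ∫ y, K x y := fun x => by
    rw [integral_gaussianReal_eq_integral_smul hsne, smul_eq_mul, ← mul_assoc,
      ← integral_const_mul]
    rfl
  simp_rw [e1]
  rw [integral_integral_swap_of_hasCompactSupport hKc hKs]
  simp_rw [hKe, integral_const_mul, mul_assoc (gaussianPDFReal 0 s _), ← smul_eq_mul (gaussianPDFReal 0 s _)]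
  rw [← integral_gaussianReal_eq_integral_smul hsne]
  have hb := norm_integral_le_of_norm_le_const (μ := gaussianReal 0 s) (C := 4 * (2 * ρ) ^ m)
    (f := fun y => gaussWave m y * ((-1) ^ (m + 1) * densityOne) *
      ∫ x, chebWave (2 * m + 1) x * Real.exp ((z y).eval x)) (.of_forall fun y => ?_)
  · simpa using hb
  · by_cases hy : y ∈ Set.Icc (-1 : ℝ) 1
    · rw [Real.norm_eq_abs, abs_mul]
      refine (mul_le_of_le_one_left (abs_nonneg _) ?_).trans
        (abs_integral_chebWave_mul_exp_le hm (by omega) (z y) (hz y) (by linarith) (hzb y hy))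
      rw [abs_mul, abs_mul, abs_pow, abs_neg, abs_one, one_pow, one_mul, abs_of_pos densityOne_pos]
      exact mul_le_one₀ (abs_gaussWave_le m y) densityOne_pos.le densityOne_le_one
    · rw [gaussWave_eq_zero m hy]
      simp only [zero_mul, norm_zero]
      positivity

lemma integral_gaussWave_mul_relu {m : ℕ} (hm : 0 < m) :
    ∫ x, relu x * gaussWave m x ∂gaussianReal 0 1 = densityOne / ((2 * m - 1) * (2 * m + 3)) := by
  rw [integral_gaussianReal_eq_integral_smul one_ne_zero]
  have : ∀ x, gaussianPDFReal 0 1 x • (relu x * gaussWave m x) =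
      ((-1) ^ (m + 1) * densityOne) * (chebWave (2 * m + 1) x * relu x) := fun x => by
    rw [smul_eq_mul, mul_left_comm, gaussianPDFReal_mul_gaussWave]; ring
  simp_rw [this]
  rw [integral_const_mul, integral_chebWave_mul_relu hm]
  have hs : ((-1 : ℝ) ^ (m + 1)) * (-1) ^ (m + 1) = 1 := by
    rw [← mul_pow]; simp
  calc _ = ((-1 : ℝ) ^ (m + 1) * (-1) ^ (m + 1)) * (densityOne / ((2 * m - 1) * (2 * m + 3))) := by
        ring
    _ = _ := by rw [hs, one_mul]

/-- The competitor is `κ` times the ReLU in direction `v`, where `κ` is its correlation with the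
wave: the loss is `1 - 2κ² + κ² E[relu²]`, and `E[relu²] ≤ 1`. -/
lemma opt_labelled_gaussWave_le {d m : ℕ} (hm : 0 < m) {v : Point d} (hv : ‖v‖ = 1) :
    opt (labelled fun x => gaussWave m (inner ℝ v x)) ≤
      ENNReal.ofReal (1 - (densityOne / ((2 * m - 1) * (2 * m + 3))) ^ 2) := by
  set κ := densityOne / ((2 * (m : ℝ) - 1) * (2 * m + 3)) with hκ
  have hm' : (1 : ℝ) ≤ m := by exact_mod_cast hm
  have hκ0 : 0 ≤ κ := div_nonneg densityOne_pos.le (mul_nonneg (by linarith) (by linarith))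
  have hw := (continuous_gaussWave m).measurable
  have hr := continuous_relu.measurable
  have hmap := map_inner_stdGaussian v
  rw [hv, one_pow, Real.toNNReal_one] at hmap
  have hunit : ∀ x : Point d, reluUnit (κ • v) 0 x = κ * relu (inner ℝ v x) := fun x => by
    rw [reluUnit, add_zero, real_inner_smul_left, relu, relu, mul_max_of_nonneg _ _ hκ0, mul_zero]
  have hrelu2 : ∀ t, relu t ^ 2 ≤ t ^ 2 := fun t => by
    rcases le_total t 0 with h | h
    · rw [relu_eq_zero h]; simpa using sq_nonneg t
    · rw [relu_of_nonneg h]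
  have hid2 : MemLp (id : ℝ → ℝ) 2 (gaussianReal 0 1) := by
    simpa using memLp_id_gaussianReal (μ := 0) (v := 1) 2
  have hreluL : MemLp relu 2 (gaussianReal 0 1) := by
    refine hid2.mono hr.aestronglyMeasurable (.of_forall fun t => ?_)
    simpa [Real.norm_eq_abs] using sq_le_sq.1 (hrelu2 t)
  have hi2 : Integrable (fun t => relu t ^ 2) (gaussianReal 0 1) := hreluL.integrable_sq
  have hi1 : Integrable (fun t => relu t * gaussWave m t) (gaussianReal 0 1) := by
    refine (hreluL.integrable one_le_two).mul_bdd (c := 1) hw.aestronglyMeasurable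
      (.of_forall fun t => abs_gaussWave_le m t)
  have h2 : ∫ t, relu t ^ 2 ∂gaussianReal 0 1 ≤ 1 := by
    have hvar : ∫ t, t ^ 2 ∂gaussianReal 0 1 = 1 := by
      have := variance_id_gaussianReal (μ := 0) (v := 1)
      rw [variance_of_integral_eq_zero (by fun_prop) (by simp)] at this
      simpa using this
    rw [← hvar]
    exact integral_mono hi2 hid2.integrable_sq hrelu2
  refine (iInf₂_le (κ • v) 0).trans ?_
  rw [sqLoss_labelled (by fun_prop) (fun x => abs_gaussWave_le m _)
    (by simp_rw [funext hunit]; fun_prop)]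
  simp_rw [hunit]
  have e : ∫⁻ x, ENNReal.ofReal ((κ * relu (inner ℝ v x)) ^ 2 -
      2 * (κ * relu (inner ℝ v x)) * gaussWave m (inner ℝ v x) + 1) ∂stdGaussian (Point d) =
      ∫⁻ t, ENNReal.ofReal (κ ^ 2 * relu t ^ 2 - 2 * κ * (relu t * gaussWave m t) + 1)
        ∂gaussianReal 0 1 := by
    rw [← hmap, lintegral_map (by fun_prop) (by fun_prop)]
    exact lintegral_congr fun x => by congr 1; ring
  have hint : Integrable (fun t => κ ^ 2 * relu t ^ 2 - 2 * κ * (relu t * gaussWave m t))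
      (gaussianReal 0 1) := (hi2.const_mul _).sub (hi1.const_mul _)
  rw [e, ← ofReal_integral_eq_lintegral_ofReal
    (show Integrable (fun t => κ ^ 2 * relu t ^ 2 - 2 * κ * (relu t * gaussWave m t) + 1) _ from
      hint.add (integrable_const 1))]
  · refine ENNReal.ofReal_le_ofReal ?_
    rw [integral_add hint (integrable_const 1),
      integral_sub (hi2.const_mul _) (hi1.const_mul _), integral_const_mul, integral_const_mul,
      integral_gaussWave_mul_relu hm, ← hκ]
    simp only [integral_const, probReal_univ, smul_eq_mul, mul_one]
    nlinarith [mul_le_mul_of_nonneg_left h2 (sq_nonneg κ)]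
  · refine .of_forall fun t => ?_
    have := (sq_le_one_iff_abs_le_one _).2 (abs_gaussWave_le m t)
    change 0 ≤ κ ^ 2 * relu t ^ 2 - 2 * κ * (relu t * gaussWave m t) + 1
    nlinarith [sq_nonneg (κ * relu t - gaussWave m t)]

/-! ### Nearly orthogonal directions from polynomials over a finite field. -/

lemma card_filter_eval_eq_le {F : Type*} [Field F] [Fintype F] [DecidableEq F] {m : ℕ}
    {c c' : Fin m → F} (h : c ≠ c') :
    (Finset.univ.filter fun a : F => ∑ i, c i * a ^ (i : ℕ) = ∑ i, c' i * a ^ (i : ℕ)).card ≤ m := by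
  let P : Polynomial F := ∑ i, Polynomial.C (c i - c' i) * Polynomial.X ^ (i : ℕ)
  have hcoeff : ∀ i : Fin m, P.coeff i = c i - c' i := fun i => by
    simp only [P, Polynomial.finsetSum_coeff, Polynomial.coeff_C_mul_X_pow, Fin.val_inj]
    simp
  have hP : P ≠ 0 := fun h0 => h <| funext fun i => by
    have := hcoeff i
    rw [h0, Polynomial.coeff_zero] at this
    exact (sub_eq_zero.1 this.symm)
  have hdeg : P.natDegree ≤ m := Polynomial.natDegree_sum_le_of_forall_le _ _ fun i _ =>
    (Polynomial.natDegree_C_mul_X_pow_le _ _).trans i.2.le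
  calc _ ≤ P.roots.toFinset.card := by
        refine Finset.card_le_card fun a ha => ?_
        rw [Multiset.mem_toFinset, Polynomial.mem_roots hP, Polynomial.IsRoot.def]
        simp only [P, Polynomial.eval_finsetSum, Polynomial.eval_mul, Polynomial.eval_C,
          Polynomial.eval_pow, Polynomial.eval_X, sub_mul, Finset.sum_sub_distrib]
        exact sub_eq_zero.2 (Finset.mem_filter.1 ha).2
    _ ≤ _ := P.roots.toFinset_card_le.trans (P.card_roots'.trans hdeg)

/-- The normalized indicators of the graphs of low-degree polynomials over a finite field are
nearly orthogonal. -/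
lemma exists_nearly_orthogonal {d p : ℕ} [Fact p.Prime] (hpd : p * p ≤ d) (m : ℕ) :
    ∃ v : (Fin m → ZMod p) → Point d, (∀ c, ‖v c‖ = 1) ∧
      ∀ c c', c ≠ c' → 0 ≤ (inner ℝ (v c) (v c') : ℝ) ∧ (inner ℝ (v c) (v c') : ℝ) ≤ m / p := by
  have hp : (0 : ℝ) < p := by exact_mod_cast (Fact.out : p.Prime).pos
  obtain ⟨e⟩ : Nonempty (ZMod p × ZMod p ↪ Fin d) :=
    Function.Embedding.nonempty_of_card_le (by simpa [ZMod.card] using hpd)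
  let P : (Fin m → ZMod p) → ZMod p → ZMod p := fun c a => ∑ i, c i * a ^ (i : ℕ)
  let v : (Fin m → ZMod p) → Point d := fun c =>
    (√p)⁻¹ • ∑ a, EuclideanSpace.single (e (a, P c a)) (1 : ℝ)
  have hinner : ∀ c c', (inner ℝ (v c) (v c') : ℝ) =
      (Finset.univ.filter fun a => P c a = P c' a).card / p := by
    intro c c'
    have h1 : ∀ a b, (inner ℝ (EuclideanSpace.single (e (a, P c a)) (1 : ℝ))
        (EuclideanSpace.single (e (b, P c' b)) (1 : ℝ)) : ℝ) =
        if a = b then (if P c a = P c' a then 1 else 0) else 0 := by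
      intro a b
      rw [EuclideanSpace.inner_single_left]
      by_cases hab : a = b
      · subst hab
        simp [e.injective.eq_iff]
      · simp [e.injective.eq_iff, hab]
    simp only [v, real_inner_smul_left, real_inner_smul_right, sum_inner, inner_sum, h1]
    simp only [← Finset.mul_sum, Finset.sum_ite_eq', Finset.mem_univ, if_true, Finset.sum_boole]
    rw [← mul_assoc, ← mul_inv, Real.mul_self_sqrt hp.le]
    field_simp
  refine ⟨v, fun c => ?_, fun c c' hcc => ?_⟩
  · have h := hinner c c
    rw [real_inner_self_eq_norm_sq] at h
    simp only [Finset.filter_true, Finset.card_univ, ZMod.card, div_self hp.ne'] at h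
    exact (pow_eq_one_iff_of_nonneg (norm_nonneg _) two_ne_zero).1 h
  · rw [hinner]
    refine ⟨by positivity, ?_⟩
    have := card_filter_eval_eq_le hcc
    gcongr

/-! ### Choice of parameters. -/

lemma exists_prime_sq_le {d : ℕ} (hd : 4 ≤ d) : ∃ p : ℕ, p.Prime ∧ p * p ≤ d ∧ d ≤ 4 * (p * p) := by
  have hs : 2 ≤ d.sqrt := Nat.le_sqrt.2 hd
  obtain ⟨p, hp, h1, h2⟩ := Nat.exists_prime_lt_and_le_two_mul (d.sqrt / 2) (by omega)
  refine ⟨p, hp, Nat.le_sqrt.1 (by omega), ?_⟩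
  have h3 := Nat.lt_succ_sqrt d
  have h4 : (d.sqrt).succ ≤ 2 * p := by omega
  nlinarith [Nat.mul_le_mul h4 h4]

/-- The lower bound in terms of integral parameters. -/
lemma lt_queries_of_learns {d m : ℕ} (hm : 0 < m) {B ε τ : ℝ} (hB : 8 ≤ B) (hBd : B ^ 100 ≤ d)
    (hmB : (m : ℝ) ≤ 2 * B) (hε : B⁻¹ ≤ ε)
    (hκ : 2 * ε ≤ (densityOne / ((2 * m - 1) * (2 * m + 3))) ^ 2)
    (hτ : (B ^ m)⁻¹ ≤ τ) {A : RandSQAlg d} {n : ℕ} (hA : A.QueriesAtMost τ n)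
    (hL : A.Learns τ ε) : B ^ m < n := by
  have hB1 : 1 ≤ B := by linarith
  have hB0 : 0 < B := by linarith
  have hBm : 8 ≤ B ^ m := hB.trans (le_self_pow₀ hB1 hm.ne')
  have hm1 : (1 : ℝ) ≤ m := by exact_mod_cast hm
  have hε0 : 0 < ε := (inv_pos.2 hB0).trans_le hε
  have hκ1 : (densityOne / ((2 * (m : ℝ) - 1) * (2 * m + 3))) ^ 2 ≤ 1 := by
    have hden : 1 ≤ (2 * (m : ℝ) - 1) * (2 * m + 3) := by nlinarith
    refine pow_le_one₀ (div_nonneg densityOne_pos.le (by linarith)) ?_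
    exact (div_le_one (by linarith)).2 (densityOne_le_one.trans hden)
  have hd4 : 4 ≤ d := by
    have : (4 : ℝ) ≤ d := by linarith [le_self_pow₀ hB1 (by norm_num : (100 : ℕ) ≠ 0)]
    exact_mod_cast this
  obtain ⟨p, hp, hpd, hdp⟩ := exists_prime_sq_le hd4
  have : Fact p.Prime := ⟨hp⟩
  have hpB : B ^ 25 ≤ p := by
    have h1 : (d : ℝ) ≤ 4 * (p * p) := by exact_mod_cast hdp
    have h2 : (4 : ℝ) ≤ B ^ 50 := by linarith [le_self_pow₀ hB1 (by norm_num : (50 : ℕ) ≠ 0)]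
    refine (pow_le_pow_iff_left₀ (by positivity) (Nat.cast_nonneg p) two_ne_zero).1 ?_
    nlinarith [pow_pos hB0 50, mul_le_mul_of_nonneg_right h2 (pow_pos hB0 50).le]
  have hp0 : (0 : ℝ) < p := (pow_pos hB0 25).trans_le hpB
  have hρ : 2 * ((m : ℝ) / p) ≤ (B ^ 19)⁻¹ := by
    rw [← mul_div_assoc, div_le_iff₀ hp0, inv_mul_eq_div, le_div_iff₀ (by positivity)]
    calc 2 * (m : ℝ) * B ^ 19 ≤ 2 * (2 * B) * B ^ 19 := by gcongr
      _ = 4 * B ^ 20 := by ring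
      _ ≤ B ^ 5 * B ^ 20 := by
          gcongr
          linarith [le_self_pow₀ hB1 (by norm_num : (5 : ℕ) ≠ 0)]
      _ = B ^ 25 := by ring
      _ ≤ p := hpB
  have hB19 : (B ^ 19)⁻¹ ≤ 1 / 8 := by
    rw [inv_le_comm₀ (by positivity) (by norm_num)]
    linarith [le_self_pow₀ hB1 (by norm_num : (19 : ℕ) ≠ 0)]
  obtain ⟨v, hv1, hv⟩ := exists_nearly_orthogonal hpd m
  -- Everything is measured in powers of `y`: at least `y ^ 25` functions, correlations at most `4 y
  -- ^ (-19)`, tolerance and `ε` at least `y⁻¹`. If `n ≤ y`, the counting bound gives `(2/3) y ^ 25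
  -- ≤ 2 y ^ 3 + 2 y`, which is absurd.
  set y : ℝ := B ^ m with hy
  have hy0 : 0 < y := by linarith
  have hyη : ((B ^ 19)⁻¹) ^ m = (y ^ 19)⁻¹ := by
    rw [inv_pow, hy, ← pow_mul, ← pow_mul, mul_comm]
  have hη : ∀ c c', c ≠ c' → |∫ x, gaussWave m (inner ℝ (v c) x) * gaussWave m (inner ℝ (v c') x)
      ∂stdGaussian (Point d)| ≤ 4 * (y ^ 19)⁻¹ := by
    intro c c' hcc
    obtain ⟨h0, h1⟩ := hv c c' hcc
    have hw := (continuous_gaussWave m).measurable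
    rw [integral_inner_mul_inner_stdGaussian (hv1 c) (hv1 c') hw hw (abs_gaussWave_le m)
      (abs_gaussWave_le m)]
    refine (abs_integral_gaussWave_le hm h0 (by linarith)).trans ?_
    rw [← hyη]
    gcongr
    linarith
  have hτ0 : 0 < τ := (inv_pos.2 hy0).trans_le hτ
  have hτ2 : (y ^ 2)⁻¹ ≤ τ ^ 2 := by
    rw [← inv_pow]; exact pow_le_pow_left₀ (inv_pos.2 hy0).le hτ 2
  have hByε : y⁻¹ ≤ ε := le_trans (inv_anti₀ hB0 (le_self_pow₀ hB1 hm.ne')) hε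
  have hsmall : ∀ k : ℕ, 1 ≤ k → k ≤ 18 → 8 * (y ^ 19)⁻¹ ≤ (y ^ k)⁻¹ := by
    intro k _ hk
    have h1 : y ^ k * 8 ≤ y ^ 19 := by
      calc y ^ k * 8 ≤ y ^ k * y := by gcongr
        _ = y ^ (k + 1) := (pow_succ _ _).symm
        _ ≤ y ^ 19 := pow_le_pow_right₀ (by linarith) (by omega)
    rw [← div_eq_mul_inv, div_le_iff₀ (by positivity), inv_mul_eq_div, le_div_iff₀ (by positivity)]
    linarith
  have hmain := RandSQAlg.card_le (f := fun c x => gaussWave m (inner ℝ (v c) x))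
    (η := 4 * (y ^ 19)⁻¹) (β := ε / 2) (ε := ε)
    (fun c => (continuous_gaussWave m).measurable.comp (by fun_prop))
    (fun c x => abs_gaussWave_le m _) (by positivity) hη hτ0
    (by linarith [hsmall 2 (by norm_num) (by norm_num)]) (by positivity)
    (by have := hsmall 1 (by norm_num) (by norm_num); rw [pow_one] at this; linarith)
    (by linarith) (fun c => by
      refine (add_le_add_left (opt_labelled_gaussWave_le hm (hv1 c)) _).trans ?_
      rw [← ENNReal.ofReal_add (by linarith) hε0.le]
      exact ENNReal.ofReal_le_ofReal (by linarith)) hA hL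
  simp only [Fintype.card_fun, ZMod.card, Fintype.card_fin, Nat.cast_pow] at hmain
  by_contra! hn
  have h1 : y ^ 25 ≤ (p : ℝ) ^ m := by
    calc y ^ 25 = (B ^ 25) ^ m := by rw [hy, ← pow_mul, ← pow_mul, mul_comm]
      _ ≤ _ := by gcongr
  have h2 : 2 / τ ^ 2 ≤ 2 * y ^ 2 := by
    rw [div_le_iff₀ (by positivity)]
    have := mul_le_mul_of_nonneg_left hτ2 (by positivity : 0 ≤ 2 * y ^ 2)
    rwa [mul_assoc 2, mul_inv_cancel₀ (by positivity), mul_one] at this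
  have h3 : 1 / (ε / 2) ≤ 2 * y := by
    rw [div_le_iff₀ (by positivity)]
    have := mul_le_mul_of_nonneg_left hByε hy0.le
    rw [mul_inv_cancel₀ hy0.ne'] at this
    linarith
  have h4 : (n : ℝ) * (2 / τ ^ 2) ≤ y * (2 * y ^ 2) :=
    mul_le_mul hn h2 (by positivity) hy0.le
  have h5 : y ^ 3 * 8 ≤ y ^ 25 := by
    calc y ^ 3 * 8 ≤ y ^ 3 * y := by gcongr
      _ = y ^ 4 := by ring
      _ ≤ y ^ 25 := pow_le_pow_right₀ (by linarith) (by norm_num)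
  have h6 : y ≤ y ^ 3 := le_self_pow₀ (by linarith) (by norm_num)
  nlinarith [pow_pos hy0 3]

end ReLURegression

theorem theorem2 :
    ∃ c c' ε₀ : ℝ, 0 < c ∧ 0 < c' ∧ 0 < ε₀ ∧
      ∀ (d : ℕ) (ε : ℝ), 1 ≤ d → (d : ℝ) ^ (-c) ≤ ε → ε ≤ ε₀ →
        ∀ (A : ReLURegression.RandSQAlg d) (n : ℕ),
          A.QueriesAtMost ((d : ℝ) ^ (-(c / ε ^ c'))) n →
          A.Learns ((d : ℝ) ^ (-(c / ε ^ c'))) ε →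
            (d : ℝ) ^ (c / ε ^ c') ≤ (n : ℝ) := by
  have hg0 := ReLURegression.densityOne_pos
  have hg1 := ReLURegression.densityOne_le_one
  set g := ReLURegression.densityOne
  -- With `a = ε ^ (1/8)` and `m = ⌈1/a⌉`, the squared ReLU correlation is at least `g² a⁴ / 1024`
  -- and must exceed `2ε = 2a⁸`; `ε₀` is chosen so that `a⁴ ≤ g² / 2048`. The exponent `1/100` makes
  -- `d = B ^ 100`.
  refine ⟨1 / 100, 1 / 8, (g ^ 2 / 2048) ^ 2, by norm_num, by norm_num, by positivity, ?_⟩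
  intro d ε hd hdε hε A n hA hL
  have hd0 : (0 : ℝ) < d := by exact_mod_cast hd
  have hε0 : 0 < ε := (Real.rpow_pos_of_pos hd0 _).trans_le hdε
  set B : ℝ := (d : ℝ) ^ (1 / 100 : ℝ) with hB
  have hB0 : 0 < B := Real.rpow_pos_of_pos hd0 _
  set a : ℝ := ε ^ (1 / 8 : ℝ) with ha
  have ha0 : 0 < a := Real.rpow_pos_of_pos hε0 _
  have ha8 : a ^ 8 = ε := by
    rw [ha, ← Real.rpow_natCast, ← Real.rpow_mul hε0.le]; norm_num
  have hBε : B⁻¹ ≤ ε := by rwa [hB, ← Real.rpow_neg hd0.le]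
  have hg2 : g ^ 2 ≤ 1 := pow_le_one₀ hg0.le hg1
  have ha4 : a ^ 4 ≤ g ^ 2 / 2048 := by
    refine (pow_le_pow_iff_left₀ (by positivity) (by positivity) two_ne_zero).1 ?_
    rw [← pow_mul]; exact ha8.le.trans hε
  have hε8 : ε ≤ 1 / 8 := by nlinarith [sq_nonneg g]
  have ha1 : a ≤ 1 := by
    by_contra! h
    linarith [one_lt_pow₀ h (by norm_num : (4 : ℕ) ≠ 0)]
  -- Small dimensions drop out here: `B⁻¹ ≤ ε ≤ 1/8` already forces `d` to be large.
  have hB8 : 8 ≤ B := by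
    have := hBε.trans hε8
    rwa [inv_le_comm₀ hB0 (by norm_num), one_div, inv_inv] at this
  have hexp : (1 / 100 : ℝ) / a = (1 / 100) * a⁻¹ := div_eq_mul_inv _ _
  rw [hexp, ← mul_neg, Real.rpow_mul hd0.le, ← hB] at hA hL
  rw [hexp, Real.rpow_mul hd0.le, ← hB]
  have hK1 : 1 ≤ a⁻¹ := (one_le_inv₀ ha0).2 ha1
  set m := ⌈a⁻¹⌉₊ with hm
  have hmK : a⁻¹ ≤ m := Nat.le_ceil _
  have hmK2 : (m : ℝ) ≤ 2 * a⁻¹ := by linarith [Nat.ceil_lt_add_one (by positivity : 0 ≤ a⁻¹)]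
  have hm0 : 0 < m := Nat.ceil_pos.2 (by positivity)
  have hle : B ^ a⁻¹ ≤ B ^ m := by
    rw [← Real.rpow_natCast]; exact Real.rpow_le_rpow_of_exponent_le (by linarith) hmK
  have hKB : a⁻¹ ≤ B := by
    rw [inv_le_comm₀ ha0 hB0]
    refine hBε.trans ?_
    rw [← ha8]
    exact pow_le_of_le_one ha0.le ha1 (by norm_num)
  refine hle.trans (ReLURegression.lt_queries_of_learns hm0 hB8 ?_ (by linarith) hBε ?_ ?_ hA hL).le
  · rw [hB, ← Real.rpow_natCast, ← Real.rpow_mul hd0.le]; norm_num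
  · have hm1 : (1 : ℝ) ≤ m := by exact_mod_cast hm0
    have hden : 0 < (2 * (m : ℝ) - 1) * (2 * m + 3) := mul_pos (by linarith) (by linarith)
    have ham : a * m ≤ 2 := by
      have := mul_le_mul_of_nonneg_left hmK2 ha0.le
      rwa [mul_left_comm, mul_inv_cancel₀ ha0.ne', mul_one] at this
    have h1 : g * a ^ 2 / 32 ≤ g / ((2 * m - 1) * (2 * m + 3)) := by
      rw [div_le_div_iff₀ (by norm_num) hden, mul_assoc]
      refine mul_le_mul_of_nonneg_left ?_ hg0.le
      have : (a * m) ^ 2 ≤ 2 ^ 2 := pow_le_pow_left₀ (by positivity) ham 2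
      have h8 : (2 * (m : ℝ) - 1) * (2 * m + 3) ≤ 8 * m ^ 2 := by nlinarith [sq_nonneg ((m : ℝ) - 1)]
      nlinarith [mul_le_mul_of_nonneg_left h8 (sq_nonneg a)]
    refine le_trans ?_ (pow_le_pow_left₀ (by positivity) h1 2)
    rw [← ha8]
    nlinarith [mul_le_mul_of_nonneg_left ha4 (by positivity : 0 ≤ a ^ 4)]
  · rw [Real.rpow_neg hB0.le]
    exact inv_anti₀ (Real.rpow_pos_of_pos hB0 _) hle
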